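/- Let $\mathbb X=(X_n)_{n\ge1}$ be a strictly stationary sequence of real random variables on a probability space $(\Omega,\mathcal F,\mathbb P)$, let $a>0$, and let $(k_n)_{n\ge1}$ be integers with $1\le k_n\le n$ for all $n$ and $k_n/n\to1$. Let $\mathcal I^{\mathbb X}$ be the $\sigma$-field of all sets $A\subseteq\Omega$ for which there is a Borel set $B\subseteq\mathbb R^{\mathbb N}$ with $A=\{\omega:(X_i(\omega),X_{i+1}(\omega),\dots)\in B\}$ for every $i\ge1$. Let $\gamma_1$ be the conditional right endpoint of the support of $X_1$ given $\mathcal I^{\mathbb X}$, that is, (a version of) the a.s. smallest $\mathcal I^{\mathbb X}$-measurable $[-\infty,\infty]$-valued random variable with $\mathbb P(X_1\le\gamma_1\mid\mathcal I^{\mathbb X})=1$ a.s. Assume $$\mathbb P(X_1=\gamma_1)=0\qquad\text{and}\qquad \mathbb P(X_1=\gamma_1-a)=0 .$$ Let $(N(t))_{t\ge0}$ be a process of non-negative integer-valued random variables, $Z$ an almost surely positive (real) random variable, all on the same probability space, and $c:[0,\infty)\to(0,\infty)$ a function with $c(t)\to\infty$ as $t\to\infty$. Write $X_{1:n}\le\dots\le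 X_{n:n}$ for the order statistics of $X_1,\dots,X_n$ and put $$\mathcal K_t(k_{N(t)},a)=\sum_{i=1}^{N(t)} I\big(X_{k_{N(t)}:N(t)}-a<X_i<X_{k_{N(t)}:N(t)}\big),\qquad W=I(\gamma_1<\infty)\cdot\mathbb P(X_1>\gamma_1-a\mid\mathcal I^{\mathbb X}),$$ the sum being $0$ when $N(t)=0$. All limits are as $t\to\infty$. (i) If $N(t)/c(t)\to Z$ almost surely, then $\mathcal K_t(k_{N(t)},a)/c(t)\to Z\cdot W$ almost surely. If $N(t)/c(t)\to Z$ in probability, then $\mathcal K_t(k_{N(t)},a)/c(t)\to Z\cdot W$ in probability. (ii) Suppose $N(t)/c(t)\to Z$ in distribution. If $W$ is degenerate (almost surely constant), then $\mathcal K_t(k_{N(t)},a)/c(t)\to Z\cdot W$ in distribution. If $Z$ is degenerate, then $N(t)/c(t)\to Z$ in probability, and hence $\mathcal K_t(k_{N(t)},a)/c(t)\to Z\cdot W$ in probability. -/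

import Mathlib

open MeasureTheory ProbabilityTheory Filter Topology
open scoped NNReal

namespace NearMax

/-- The `k`-th smallest among `x 0, …, x (n - 1)` (counted with multiplicity), for `1 ≤ k ≤ n`.
Sequences are indexed from `0`, so `x i` is the `(i + 1)`-st term. For other `k` the value is `0`
by convention. -/
noncomputable def orderStat (x : ℕ → ℝ) (k n : ℕ) : ℝ :=
  if h : 1 ≤ k ∧ k ≤ n then
    x (Tuple.sort (fun i : Fin n => x i) ⟨k - 1, by omega⟩)
  else 0

/-- The number of those among the first `n` terms of `x` that lie in the open interval of length
`a` to the left of the `k`-th order statistic of these `n` terms. -/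
noncomputable def nearCount (x : ℕ → ℝ) (k n : ℕ) (a : ℝ) : ℕ :=
  ((Finset.range n).filter
    (fun i => orderStat x k n - a < x i ∧ x i < orderStat x k n)).card

/-- Strict stationarity: every shifted sequence has the same law on `ℝ^ℕ` as the sequence. -/
def StrictlyStationary {Ω : Type*} [MeasurableSpace Ω] (μ : Measure Ω) (X : ℕ → Ω → ℝ) : Prop :=
  ∀ h : ℕ, IdentDistrib (fun ω (n : ℕ) => X (n + h) ω) (fun ω (n : ℕ) => X n ω) μ μ

/-- The sigma-field of the sets invariant with respect to the sequence `X`: those `A` for which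
there is one Borel set `B` of `ℝ^ℕ` with `A = {ω | (X i ω, X (i + 1) ω, …) ∈ B}` for every `i`. -/
@[reducible]
def invariantSigma {Ω : Type*} (X : ℕ → Ω → ℝ) : MeasurableSpace Ω where
  MeasurableSet' A := ∃ B : Set (ℕ → ℝ), MeasurableSet B ∧
    ∀ i : ℕ, A = {ω | (fun n : ℕ => X (i + n) ω) ∈ B}
  measurableSet_empty := ⟨∅, MeasurableSet.empty, fun _ => by simp⟩
  measurableSet_compl := by
    rintro A ⟨B, hB, hA⟩
    exact ⟨Bᶜ, hB.compl, fun i => by rw [hA i]; rfl⟩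
  measurableSet_iUnion := by
    intro f hf
    choose B hB hA using hf
    refine ⟨⋃ j, B j, MeasurableSet.iUnion hB, fun i => ?_⟩
    ext ω
    simp only [Set.mem_iUnion, Set.mem_ofPred_eq]
    refine exists_congr fun j => ?_
    rw [hA j i]
    rfl

lemma invariantSigma_le {Ω : Type*} [mΩ : MeasurableSpace Ω] {X : ℕ → Ω → ℝ}
    (hX : ∀ n, Measurable (X n)) : invariantSigma X ≤ mΩ := by
  rintro A ⟨B, hB, hA⟩
  rw [hA 0]
  exact (measurable_pi_lambda _ fun n => hX (0 + n)) hB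

/-- `Q` is (a version of) the conditional right endpoint of the support of `X` given `𝓖`: the
a.s. smallest `𝓖`-measurable extended random variable with `P(X ≤ Q | 𝓖) = 1` a.s. -/
structure IsCondRightEndpoint {Ω : Type*} [MeasurableSpace Ω] (μ : Measure Ω)
    (X : Ω → ℝ) (𝓖 : MeasurableSpace Ω) (Q : Ω → EReal) : Prop where
  measurable : Measurable[𝓖] Q
  condProb_eq_one : ∀ᵐ ω ∂μ, (μ⟦{ω' | (X ω' : EReal) ≤ Q ω'} | 𝓖⟧) ω = 1
  minimal : ∀ Q' : Ω → EReal, Measurable[𝓖] Q' →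
    (∀ᵐ ω ∂μ, (μ⟦{ω' | (X ω' : EReal) ≤ Q' ω'} | 𝓖⟧) ω = 1) → ∀ᵐ ω ∂μ, Q ω ≤ Q' ω

lemma condProb_eq_one_iff {Ω : Type*} {𝓖 : MeasurableSpace Ω} [mΩ : MeasurableSpace Ω]
    {μ : Measure Ω} [IsProbabilityMeasure μ] (h𝓖 : 𝓖 ≤ mΩ) {A : Set Ω}
    (hA : MeasurableSet A) :
    (∀ᵐ ω ∂μ, (μ⟦A | 𝓖⟧) ω = 1) ↔ ∀ᵐ ω ∂μ, ω ∈ A := by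
  constructor
  · intro h
    have h1 : ∫ ω, (μ⟦A | 𝓖⟧) ω ∂μ = ∫ _ω, (1 : ℝ) ∂μ := integral_congr_ae h
    rw [integral_condExp h𝓖] at h1
    have h2 : μ.real A = 1 := by simpa [integral_indicator hA] using h1
    have h3 : μ A = 1 := by
      rw [← ENNReal.toReal_eq_one_iff]
      exact h2
    exact (prob_compl_eq_zero_iff hA).2 h3
  · intro h
    have h1 : A.indicator (fun _ => (1 : ℝ)) =ᵐ[μ] fun _ => 1 := by
      filter_upwards [h] with ω hω
      simp [hω]
    have h2 := condExp_congr_ae (m := 𝓖) h1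
    rw [condExp_const h𝓖] at h2
    exact h2

/-- A conditional right endpoint always exists. -/
theorem exists_isCondRightEndpoint {Ω : Type*} {𝓖 : MeasurableSpace Ω} [mΩ : MeasurableSpace Ω]
    (μ : Measure Ω) [IsProbabilityMeasure μ] {X : Ω → ℝ} (hX : Measurable X)
    (h𝓖 : 𝓖 ≤ mΩ) : ∃ Q : Ω → EReal, IsCondRightEndpoint μ X 𝓖 Q := by
  classical
  let A : ℚ → Set Ω := fun q => {ω | X ω ≤ (q : ℝ)}
  have hA : ∀ q, MeasurableSet (A q) := fun q => measurableSet_le hX measurable_const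
  let f : ℚ → Ω → ℝ := fun q => μ⟦A q | 𝓖⟧
  have hf : ∀ q, Measurable[𝓖] (f q) := fun q => stronglyMeasurable_condExp.measurable
  have hint : ∀ q, Integrable ((A q).indicator fun _ => (1 : ℝ)) μ := fun q =>
    (integrable_const 1).indicator (hA q)
  let S : ℚ → Set Ω := fun q => {ω | 1 ≤ f q ω}
  have hS : ∀ q, MeasurableSet[𝓖] (S q) := fun q => @measurableSet_le _ _ _ _ _ 𝓖 _ _ _ _ _
    (@measurable_const _ _ _ 𝓖 _) (hf q)
  let Q : Ω → EReal := fun ω => ⨅ q : ℚ, if ω ∈ S q then ((q : ℝ) : EReal) else ⊤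
  have hQ : Measurable[𝓖] Q := by
    refine Measurable.iInf fun q => ?_
    exact Measurable.ite (f := fun _ => ((q : ℝ) : EReal)) (g := fun _ => ⊤) (hS q)
      measurable_const measurable_const
  have hle : ∀ R : Ω → EReal, Measurable[𝓖] R → MeasurableSet {ω | (X ω : EReal) ≤ R ω} :=
    fun R hR => measurableSet_le (measurable_coe_real_ereal.comp hX) (hR.mono h𝓖 le_rfl)
  refine ⟨Q, hQ, ?_, ?_⟩
  · rw [condProb_eq_one_iff h𝓖 (hle Q hQ)]
    have key : ∀ q, ∀ᵐ ω ∂μ, ω ∈ S q → X ω ≤ (q : ℝ) := by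
      intro q
      have h1 : ∫ ω in S q, f q ω ∂μ = μ.real (S q ∩ A q) := by
        rw [setIntegral_condExp h𝓖 (hint q) (hS q)]
        simp [integral_indicator (hA q), Measure.real, Measure.restrict_apply (hA q), Set.inter_comm]
      have h2 : μ.real (S q) ≤ ∫ ω in S q, f q ω ∂μ := by
        have := setIntegral_mono_on (μ := μ) (s := S q) (f := fun _ => (1 : ℝ)) (g := f q)
          (integrable_const 1).integrableOn integrable_condExp.integrableOn (h𝓖 _ (hS q))
          (fun ω hω => hω)
        simpa using this
      have h3 : μ.real (S q \ A q) = 0 := by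
        have := measureReal_inter_add_sdiff (μ := μ) (s := S q) (hA q)
        have h4 := measureReal_nonneg (μ := μ) (s := S q \ A q)
        linarith
      have h5 : μ (S q \ A q) = 0 := by
        rwa [measureReal_eq_zero_iff] at h3
      rw [ae_iff]
      refine measure_mono_null (fun ω hω => ?_) h5
      simp only [Set.mem_ofPred_eq, Classical.not_imp] at hω
      exact ⟨hω.1, hω.2⟩
    filter_upwards [ae_all_iff.2 key] with ω hω
    refine le_iInf fun q => ?_
    split_ifs with h
    · exact EReal.coe_le_coe_iff.2 (hω q h)
    · exact le_top
  · intro R hR hR1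
    rw [condProb_eq_one_iff h𝓖 (hle R hR)] at hR1
    have key : ∀ q : ℚ, ∀ᵐ ω ∂μ, R ω ≤ ((q : ℝ) : EReal) → ω ∈ S q := by
      intro q
      have hT : MeasurableSet[𝓖] {ω | R ω ≤ ((q : ℝ) : EReal)} :=
        @measurableSet_le _ _ _ _ _ 𝓖 _ _ _ _ _ hR (@measurable_const _ _ _ 𝓖 _)
      have h0 : ((A q).indicator (fun _ => (1 : ℝ)) - fun _ => (1 : ℝ))
          =ᵐ[μ.restrict {ω | R ω ≤ ((q : ℝ) : EReal)}] 0 := by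
        rw [Filter.EventuallyEq, ae_restrict_iff' (h𝓖 _ hT)]
        filter_upwards [hR1] with ω h1 h2
        have : X ω ≤ (q : ℝ) := EReal.coe_le_coe_iff.1 (le_trans h1 h2)
        have h3 : ω ∈ A q := this
        simp [h3]
      have h1 := condExp_ae_eq_restrict_zero hT h0
      rw [Filter.EventuallyEq, ae_restrict_iff' (h𝓖 _ hT)] at h1
      have h2 := condExp_sub (hint q) (integrable_const (1 : ℝ)) (μ := μ) 𝓖
      rw [condExp_const h𝓖] at h2
      filter_upwards [h1, h2] with ω h3 h4 h5
      have h6 := h3 h5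
      rw [h4] at h6
      have h7 : f q ω - 1 = 0 := h6
      exact (sub_eq_zero.1 h7).ge
    filter_upwards [ae_all_iff.2 key] with ω hω
    refine le_of_forall_gt fun y hy => ?_
    obtain ⟨q, hq1, hq2⟩ := EReal.lt_iff_exists_rat_btwn.1 hy
    refine lt_of_le_of_lt (iInf_le _ q) ?_
    rw [if_pos (hω q hq1.le)]
    exact hq2

/-- `I(γ < ∞) · P(X > γ - a | 𝓖)`. -/
noncomputable def limitProportion {Ω : Type*} [MeasurableSpace Ω] (μ : Measure Ω)
    (X : Ω → ℝ) (𝓖 : MeasurableSpace Ω) (γ : Ω → EReal) (a : ℝ) : Ω → ℝ :=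
  Set.indicator {ω | γ ω < ⊤} (μ⟦{ω' | γ ω' - (a : EReal) < (X ω' : EReal)} | 𝓖⟧)

/-- A random variable is degenerate if it is almost surely equal to a constant. -/
def Degenerate {Ω : Type*} [MeasurableSpace Ω] (μ : Measure Ω) (W : Ω → ℝ) : Prop :=
  ∃ r : ℝ, ∀ᵐ ω ∂μ, W ω = r

end NearMax

/-!
By Birkhoff's theorem the empirical distributions of almost every sample path converge to the
conditional law of `X 0` given the invariant sigma-field, whose right endpoint is `γ`. All terms lie
below `γ`, while a positive proportion of them exceeds any level below `γ`; since `k n / n → 1`, the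
order statistic of rank `k n` therefore tends to `γ`, and the proportion of terms within `a` below
it tends to the conditional probability of `X 0 > γ - a`, which is `0` if `γ = ∞`. Finally
`N t → ∞` because `Z > 0`, so this proportion may be evaluated along `N t` and multiplied by
`N t / c t → Z`.
-/

namespace NearMax

section ErgodicTheorem

variable {α : Type*} {T : α → α} {f : α → ℝ}

/-- The maximum of the Birkhoff sums of `f` of lengths `0, …, n`. The sum of length `0` makes it
nonnegative. -/
noncomputable def maxBirkhoffSum (T : α → α) (f : α → ℝ) (n : ℕ) : α → ℝ :=
  partialSups (birkhoffSum T f) n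

lemma maxBirkhoffSum_apply (n : ℕ) (x : α) :
    maxBirkhoffSum T f n x = partialSups (fun k => birkhoffSum T f k x) n :=
  Pi.partialSups_apply _ _ _

lemma maxBirkhoffSum_succ (n : ℕ) (x : α) :
    maxBirkhoffSum T f (n + 1) x = max 0 (f x + maxBirkhoffSum T f n (T x)) := by
  simp only [maxBirkhoffSum_apply, partialSups_add_one', birkhoffSum_zero,
    ← partialSups_const_add, ← birkhoffSum_succ', Nat.bot_eq_zero, Function.comp_def]

lemma monotone_maxBirkhoffSum : Monotone (maxBirkhoffSum T f) :=
  (partialSups (birkhoffSum T f)).monotone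

lemma maxBirkhoffSum_nonneg (n : ℕ) (x : α) : 0 ≤ maxBirkhoffSum T f n x :=
  (birkhoffSum_zero T f x).ge.trans (le_partialSups_of_le (birkhoffSum T f) n.zero_le x)

/-- The points whose Birkhoff sums are unbounded above. -/
def unboundedBirkhoffSet (T : α → α) (f : α → ℝ) : Set α :=
  {x | ¬ BddAbove (Set.range fun n => birkhoffSum T f n x)}

lemma preimage_unboundedBirkhoffSet :
    T ⁻¹' unboundedBirkhoffSet T f = unboundedBirkhoffSet T f := by
  ext x
  refine not_congr ⟨?_, ?_⟩
  · rintro ⟨C, hC⟩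
    refine ⟨max 0 (f x + C), Set.forall_mem_range.2 fun n => ?_⟩
    cases n with
    | zero => simp
    | succ n =>
      rw [birkhoffSum_succ']
      exact le_max_of_le_right (by linarith [hC (Set.mem_range_self n)])
  · rintro ⟨C, hC⟩
    refine ⟨C - f x, Set.forall_mem_range.2 fun n => ?_⟩
    have := hC (Set.mem_range_self (n + 1))
    simp only [birkhoffSum_succ'] at this
    linarith

lemma tendsto_maxBirkhoffSum_atTop {x : α} (hx : x ∈ unboundedBirkhoffSet T f) :
    Tendsto (fun n => maxBirkhoffSum T f n x) atTop atTop := by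
  refine tendsto_atTop_atTop_of_monotone' (fun _ _ h => monotone_maxBirkhoffSum h x) ?_
  simpa only [maxBirkhoffSum_apply, bddAbove_range_partialSups] using! hx

variable [MeasurableSpace α] {ν : Measure α}

lemma measurable_birkhoffSum (hT : Measurable T) (hf : Measurable f) (n : ℕ) :
    Measurable (birkhoffSum T f n) :=
  Finset.measurable_fun_sum _ fun k _ => hf.comp (hT.iterate k)

lemma measurableSet_invariants_unboundedBirkhoffSet (hT : Measurable T) (hf : Measurable f) :
    MeasurableSet[MeasurableSpace.invariants T] (unboundedBirkhoffSet T f) :=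
  ⟨(measurableSet_bddAbove_range fun n => measurable_birkhoffSum hT hf n).compl,
    preimage_unboundedBirkhoffSet⟩

lemma integrable_maxBirkhoffSum (hT : MeasurePreserving T ν ν) (hf : Integrable f ν) (n : ℕ) :
    Integrable (maxBirkhoffSum T f n) ν := by
  have hS (n : ℕ) : Integrable (birkhoffSum T f n) ν :=
    integrable_finsetSum _ fun k _ => (hT.iterate k).integrable_comp_of_integrable hf
  induction n with
  | zero => simpa only [maxBirkhoffSum, partialSups_zero] using hS 0
  | succ n ih => simpa only [maxBirkhoffSum, partialSups_add_one] using ih.sup (hS (n + 1))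

lemma integral_maxBirkhoffSum_succ_sub_comp_nonneg (hT : MeasurePreserving T ν ν)
    (hf : Integrable f ν) (n : ℕ) :
    0 ≤ ∫ x, (maxBirkhoffSum T f (n + 1) x - maxBirkhoffSum T f n (T x)) ∂ν := by
  have hM := integrable_maxBirkhoffSum hT hf
  have h_comp : ∫ x, maxBirkhoffSum T f n (T x) ∂ν = ∫ x, maxBirkhoffSum T f n x ∂ν := by
    have h := integral_map hT.aemeasurable (hT.map_eq.symm ▸ (hM n).aestronglyMeasurable)
    rw [← h, hT.map_eq]
  rw [integral_sub (hM _) (by exact hT.integrable_comp_of_integrable (hM n)), h_comp, sub_nonneg]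
  exact integral_mono (hM n) (hM _) (monotone_maxBirkhoffSum n.le_succ)

/-- The increments `max_{k ≤ n+1} Sₖ - (max_{k ≤ n} Sₖ) ∘ T = max (-(max_{k ≤ n} Sₖ) ∘ T) f` have
nonnegative integrals, are dominated by `|f|`, and are eventually equal to `f` where the Birkhoff
sums are unbounded above. -/
theorem integral_nonneg_of_ae_mem_unboundedBirkhoffSet (hT : MeasurePreserving T ν ν)
    (hf : Integrable f ν) (h : ∀ᵐ x ∂ν, x ∈ unboundedBirkhoffSet T f) : 0 ≤ ∫ x, f x ∂ν := by
  have h_incr (n : ℕ) (x : α) : maxBirkhoffSum T f (n + 1) x - maxBirkhoffSum T f n (T x) =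
      max (-maxBirkhoffSum T f n (T x)) (f x) := by
    rw [maxBirkhoffSum_succ, ← max_sub_sub_right, zero_sub, add_sub_cancel_right]
  have hM := integrable_maxBirkhoffSum hT hf
  refine ge_of_tendsto' (tendsto_integral_of_dominated_convergence (fun x => |f x|)
    (fun n => ((hM (n + 1)).sub (hT.integrable_comp_of_integrable (hM n))).aestronglyMeasurable)
    hf.abs (fun n => .of_forall fun x => ?_) ?_)
    (integral_maxBirkhoffSum_succ_sub_comp_nonneg hT hf)
  · have h_nonneg : 0 ≤ maxBirkhoffSum T f n (T x) := maxBirkhoffSum_nonneg n _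
    simp only [Pi.sub_apply, Function.comp_apply, h_incr, Real.norm_eq_abs]
    exact abs_le.2 ⟨le_max_of_le_right (neg_abs_le _),
      max_le (by linarith [abs_nonneg (f x)]) (le_abs_self _)⟩
  · filter_upwards [h] with x hx
    rw [← preimage_unboundedBirkhoffSet] at hx
    refine tendsto_nhds_of_eventually_eq ?_
    filter_upwards [(tendsto_maxBirkhoffSum_atTop hx).eventually_ge_atTop (-f x)] with n hn
    exact (h_incr n x).trans (max_eq_right (by linarith))

theorem ae_bddAbove_birkhoffSum_of_condExp_neg [IsFiniteMeasure ν] (hT : MeasurePreserving T ν ν)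
    (hfm : Measurable f) (hf : Integrable f ν)
    (h_neg : ∀ᵐ x ∂ν, (ν[f | MeasurableSpace.invariants T]) x < 0) :
    ∀ᵐ x ∂ν, BddAbove (Set.range fun n => birkhoffSum T f n x) := by
  set A := unboundedBirkhoffSet T f
  have hA := measurableSet_invariants_unboundedBirkhoffSet hT.measurable hfm
  have hA' : MeasurableSet A := hA.1
  have hTA : MeasurePreserving T (ν.restrict A) (ν.restrict A) := by
    simpa only [A, preimage_unboundedBirkhoffSet] using hT.restrict_preimage hA'
  have h_nonneg : 0 ≤ ∫ x in A, (ν[f | MeasurableSpace.invariants T]) x ∂ν := by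
    rw [setIntegral_condExp (MeasurableSpace.invariants_le T) hf hA]
    exact integral_nonneg_of_ae_mem_unboundedBirkhoffSet hTA hf.integrableOn
      (ae_restrict_mem hA')
  have h_nonpos : 0 ≤ᵐ[ν.restrict A] -ν[f | MeasurableSpace.invariants T] :=
    ae_restrict_of_ae (h_neg.mono fun x hx => (neg_pos.2 hx).le)
  have h_zero := (integral_eq_zero_iff_of_nonneg_ae h_nonpos
    integrable_condExp.neg.integrableOn).1 <| le_antisymm
      (by simpa only [Pi.neg_apply, integral_neg, neg_nonpos] using h_nonneg)
      (integral_nonneg_of_ae h_nonpos)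
  filter_upwards [h_neg, (ae_restrict_iff' hA').1 h_zero] with x hx_neg hx_zero
  by_contra hx
  exact hx_neg.ne (neg_eq_zero.1 (hx_zero hx))

lemma ae_eventually_birkhoffAverage_lt [IsFiniteMeasure ν] (hT : MeasurePreserving T ν ν)
    (hfm : Measurable f) (hf : Integrable f ν) {ε : ℝ} (hε : 0 < ε) :
    ∀ᵐ x ∂ν, ∀ᶠ n in atTop,
      birkhoffAverage ℝ T f n x < (ν[f | MeasurableSpace.invariants T]) x + ε := by
  have hI : MeasurableSpace.invariants T ≤ _ := MeasurableSpace.invariants_le T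
  set c := ν[f | MeasurableSpace.invariants T] + fun _ => ε / 2
  have hc : StronglyMeasurable[MeasurableSpace.invariants T] c :=
    stronglyMeasurable_condExp.add stronglyMeasurable_const
  have hc_int : Integrable c ν := integrable_condExp.add (integrable_const _)
  have h_neg : ∀ᵐ x ∂ν, (ν[f - c | MeasurableSpace.invariants T]) x < 0 := by
    filter_upwards [condExp_sub hf hc_int (MeasurableSpace.invariants T)] with x hx
    rw [hx, condExp_of_stronglyMeasurable hI hc hc_int]
    simp [c, hε]
  filter_upwards [ae_bddAbove_birkhoffSum_of_condExp_neg hT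
    (hfm.sub (hc.measurable.mono hI le_rfl)) (hf.sub hc_int) h_neg] with x ⟨C, hC⟩
  have h_large := (tendsto_natCast_atTop_atTop (R := ℝ)).eventually_gt_atTop (C / (ε / 2))
  filter_upwards [h_large, eventually_gt_atTop 0] with n hn hn_pos
  have hn_pos' : (0 : ℝ) < n := by exact_mod_cast hn_pos
  have h_bound := hC (Set.mem_range_self n)
  simp only [birkhoffSum_sub,
    birkhoffSum_of_comp_eq (MeasurableSpace.comp_eq_of_measurable_invariants hc.measurable),
    Pi.smul_apply, nsmul_eq_mul, c, Pi.add_apply] at h_bound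
  rw [div_lt_iff₀ (by positivity)] at hn
  rw [birkhoffAverage, smul_eq_mul, inv_mul_lt_iff₀ hn_pos']
  linarith

lemma ae_tendsto_birkhoffAverage_of_measurable [IsFiniteMeasure ν] (hT : MeasurePreserving T ν ν)
    (hfm : Measurable f) (hf : Integrable f ν) :
    ∀ᵐ x ∂ν, Tendsto (fun n => birkhoffAverage ℝ T f n x) atTop
      (𝓝 ((ν[f | MeasurableSpace.invariants T]) x)) := by
  have h_lt {g : α → ℝ} (hgm : Measurable g) (hg : Integrable g ν) :
      ∀ᵐ x ∂ν, ∀ m : ℕ, ∀ᶠ n in atTop, birkhoffAverage ℝ T g n x <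
        (ν[g | MeasurableSpace.invariants T]) x + 1 / ((m : ℝ) + 1) :=
    ae_all_iff.2 fun m => ae_eventually_birkhoffAverage_lt hT hgm hg (by positivity)
  filter_upwards [h_lt hfm hf, h_lt hfm.neg hf.neg,
    condExp_neg f (MeasurableSpace.invariants T) (μ := ν)] with x h_upper h_lower h_neg
  refine tendsto_order.2 ⟨fun b hb => ?_, fun b hb => ?_⟩
  · obtain ⟨m, hm⟩ := exists_nat_one_div_lt (sub_pos.2 hb)
    filter_upwards [h_lower m] with n hn
    rw [h_neg] at hn
    simp only [birkhoffAverage_neg, Pi.neg_apply] at hn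
    linarith
  · obtain ⟨m, hm⟩ := exists_nat_one_div_lt (sub_pos.2 hb)
    filter_upwards [h_upper m] with n hn
    linarith

/-- Birkhoff's pointwise ergodic theorem. -/
theorem ae_tendsto_birkhoffAverage [IsFiniteMeasure ν] (hT : MeasurePreserving T ν ν)
    (hf : Integrable f ν) :
    ∀ᵐ x ∂ν, Tendsto (fun n => birkhoffAverage ℝ T f n x) atTop
      (𝓝 ((ν[f | MeasurableSpace.invariants T]) x)) := by
  set g := hf.aestronglyMeasurable.mk f
  have hfg : f =ᵐ[ν] g := hf.aestronglyMeasurable.ae_eq_mk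
  have h_avg : ∀ᵐ x ∂ν, ∀ n, birkhoffAverage ℝ T f n x = birkhoffAverage ℝ T g n x :=
    ae_all_iff.2 fun n =>
      hT.quasiMeasurePreserving.birkhoffAverage_ae_eq_of_ae_eq ℝ hfg n
  filter_upwards [h_avg, condExp_congr_ae (m := MeasurableSpace.invariants T) hfg,
    ae_tendsto_birkhoffAverage_of_measurable hT
      hf.aestronglyMeasurable.stronglyMeasurable_mk.measurable (hf.congr hfg)]
    with x h_eq h_cond h_lim
  simpa only [h_eq, h_cond] using h_lim

end ErgodicTheorem

section CondExp

theorem condExp_map_comp_ae_eq {Ω β : Type*} [MeasurableSpace Ω] {m mβ : MeasurableSpace β}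
    {μ : Measure Ω} [IsFiniteMeasure μ] (hm : m ≤ mβ) {g : Ω → β} (hg : Measurable g)
    {f : β → ℝ} (hf : Integrable f (μ.map g)) :
    (μ.map g)[f | m] ∘ g =ᵐ[μ] μ[f ∘ g | m.comap g] := by
  have hf_comp : Integrable (f ∘ g) μ := hf.comp_measurable hg
  have hc_comp : Integrable ((μ.map g)[f | m] ∘ g) μ := integrable_condExp.comp_measurable hg
  refine ae_eq_condExp_of_forall_setIntegral_eq ((MeasurableSpace.comap_mono hm).trans hg.comap_le)
    hf_comp (fun _ _ _ => hc_comp.integrableOn) ?_ ?_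
  · rintro _ ⟨s, hs, rfl⟩ -
    have h_set {u : β → ℝ} (hu : Integrable u (μ.map g)) :
        ∫ x in g ⁻¹' s, u (g x) ∂μ = ∫ y in s, u y ∂μ.map g :=
      (setIntegral_map (hm s hs) hu.aestronglyMeasurable hg.aemeasurable).symm
    exact (h_set integrable_condExp).trans
      ((setIntegral_condExp hm hf hs).trans (h_set hf).symm)
  · exact (stronglyMeasurable_condExp.comp_measurable
      (comap_measurable g)).aestronglyMeasurable

end CondExp

section Stationary

/-- The left shift on real sequences. -/
def shift (x : ℕ → ℝ) : ℕ → ℝ := fun n => x (n + 1)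

lemma measurable_shift : Measurable shift :=
  measurable_pi_lambda _ fun n => measurable_pi_apply (n + 1)

lemma shift_iterate_apply (i : ℕ) (x : ℕ → ℝ) (n : ℕ) : shift^[i] x n = x (i + n) := by
  induction i generalizing n with
  | zero => rw [Function.iterate_zero_apply, zero_add]
  | succ i ih => rw [Function.iterate_succ_apply', shift, ih, Nat.add_right_comm, add_assoc]

variable {Ω : Type*} {X : ℕ → Ω → ℝ}

/-- The sample path of a process, as a random element of `ℝ^ℕ`. -/
def path (X : ℕ → Ω → ℝ) (ω : Ω) : ℕ → ℝ := fun n => X n ω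

lemma setOf_shifted_mem (i : ℕ) (B : Set (ℕ → ℝ)) :
    {ω | (fun n => X (i + n) ω) ∈ B} = path X ⁻¹' (shift^[i] ⁻¹' B) := by
  ext ω
  simp only [Set.mem_ofPred_eq, Set.mem_preimage, funext (shift_iterate_apply i (path X ω)), path]

/-- A set `B` representing an `X`-invariant event need not be shift invariant, but its limit
superior along the shift is, and it represents the same event. -/
theorem invariantSigma_eq_comap :
    invariantSigma X = (MeasurableSpace.invariants shift).comap (path X) := by
  refine le_antisymm ?_ ?_
  · rintro A ⟨B, hB, hA⟩
    simp only [setOf_shifted_mem] at hA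
    refine ⟨limsup (fun n => shift^[n] ⁻¹' B) atTop,
      ⟨.measurableSet_limsup fun n => measurable_shift.iterate n hB, ?_⟩, ?_⟩
    · simp only [Set.preimage_iterate_eq]
      exact (CompleteLatticeHom.setPreimage shift).apply_limsup_iterate B
    · ext ω
      simp only [Set.mem_preimage, mem_limsup_iff_frequently_mem]
      have (n : ℕ) : shift^[n] (path X ω) ∈ B ↔ ω ∈ A := by rw [hA n]; rfl
      simp only [this, frequently_const]
  · rintro _ ⟨D, ⟨hD, hD_inv⟩, rfl⟩
    refine ⟨D, hD, fun i => ?_⟩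
    rw [setOf_shifted_mem, Set.preimage_iterate_eq, Function.iterate_fixed hD_inv]

variable [MeasurableSpace Ω] {μ : Measure Ω}

lemma measurable_path (hX : ∀ n, Measurable (X n)) : Measurable (path X) :=
  measurable_pi_lambda _ hX

lemma StrictlyStationary.measurePreserving_shift (h : StrictlyStationary μ X)
    (hX : ∀ n, Measurable (X n)) :
    MeasurePreserving shift (μ.map (path X)) (μ.map (path X)) :=
  ⟨measurable_shift, (Measure.map_map measurable_shift (measurable_path hX)).trans (h 1).map_eq⟩

theorem StrictlyStationary.ae_tendsto_birkhoffAverage [IsFiniteMeasure μ]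
    (h : StrictlyStationary μ X) (hX : ∀ n, Measurable (X n)) {f : (ℕ → ℝ) → ℝ}
    (hf : Integrable f (μ.map (path X))) :
    ∀ᵐ ω ∂μ, Tendsto (fun n => birkhoffAverage ℝ shift f n (path X ω)) atTop
      (𝓝 ((μ[f ∘ path X | invariantSigma X]) ω)) := by
  filter_upwards [ae_of_ae_map (measurable_path hX).aemeasurable
      (NearMax.ae_tendsto_birkhoffAverage (h.measurePreserving_shift hX) hf),
    condExp_map_comp_ae_eq (MeasurableSpace.invariants_le shift) (measurable_path hX) hf]
    with ω h_lim h_eq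
  rwa [invariantSigma_eq_comap, ← h_eq]

lemma StrictlyStationary.ae_forall_le (h : StrictlyStationary μ X) (hX : ∀ n, Measurable (X n))
    {γ : Ω → EReal} (hγ : Measurable[invariantSigma X] γ) (h_le : ∀ᵐ ω ∂μ, (X 0 ω : EReal) ≤ γ ω) :
    ∀ᵐ ω ∂μ, ∀ i, (X i ω : EReal) ≤ γ ω := by
  rw [invariantSigma_eq_comap] at hγ
  obtain ⟨g, hg, rfl⟩ :=
    Measurable.exists_eq_measurable_comp (mY := MeasurableSpace.invariants shift) hγ
  have h_inv := MeasurableSpace.comp_eq_of_measurable_invariants hg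
  have hg' : Measurable g := hg.mono (MeasurableSpace.invariants_le shift) le_rfl
  have h_path : ∀ᵐ x ∂μ.map (path X), (x 0 : EReal) ≤ g x :=
    (ae_map_iff (measurable_path hX).aemeasurable
      (measurableSet_le (measurable_pi_apply 0).coe_real_ereal hg')).2 h_le
  refine ae_all_iff.2 fun i => ?_
  have h_path_i : ∀ᵐ x ∂μ.map (path X), (x i : EReal) ≤ g x := by
    filter_upwards [((h.measurePreserving_shift hX).iterate i).quasiMeasurePreserving.ae h_path]
      with x hx
    rwa [shift_iterate_apply, add_zero, ← Function.comp_apply (f := g),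
      Function.iterate_invariant h_inv] at hx
  exact ae_of_ae_map (measurable_path hX).aemeasurable h_path_i

end Stationary

section OrderStatistics

variable {x : ℕ → ℝ} {k n : ℕ} {a b : ℝ}

lemma orderStat_le_of_forall_le (hk : 1 ≤ k) (hkn : k ≤ n) {g : EReal}
    (hx : ∀ i, (x i : EReal) ≤ g) : (orderStat x k n : EReal) ≤ g := by
  rw [orderStat, dif_pos ⟨hk, hkn⟩]
  exact hx _

lemma orderStat_le_iff (hk : 1 ≤ k) (hkn : k ≤ n) :
    orderStat x k n ≤ b ↔ k ≤ {i ∈ Finset.range n | x i ≤ b}.card := by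
  set σ := Tuple.sort fun i : Fin n => x i
  have h_sorted : Monotone fun j => x (σ j) := Tuple.monotone_sort fun i : Fin n => x i
  have h_card : (Finset.univ.filter fun j => x (σ j) ≤ b).card =
      {i ∈ Finset.range n | x i ≤ b}.card := by
    simp only [Finset.card_filter]
    rw [Equiv.sum_comp σ fun j => if x j ≤ b then 1 else 0,
      Fin.sum_univ_eq_sum_range fun i => if x i ≤ b then 1 else 0]
  rw [orderStat, dif_pos ⟨hk, hkn⟩, ← h_card,
    ← Tuple.lt_card_le_iff_apply_le_of_monotone (j := ⟨k - 1, by omega⟩) h_sorted]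
  change k - 1 < _ ↔ _
  omega

lemma measurable_card_filter_range {α : Type*} [MeasurableSpace α] (n : ℕ) {p : ℕ → α → Prop}
    [∀ y, DecidablePred fun i => p i y] (hp : ∀ i, MeasurableSet {y | p i y}) :
    Measurable fun y => {i ∈ Finset.range n | p i y}.card := by
  simp only [Finset.card_filter]
  exact Finset.measurable_fun_sum _ fun i _ =>
    Measurable.ite (hp i) measurable_const measurable_const

lemma measurable_orderStat (k n : ℕ) : Measurable fun x => orderStat x k n := by
  by_cases h : 1 ≤ k ∧ k ≤ n
  · refine measurable_of_Iic fun b => ?_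
    simp only [Set.preimage, Set.mem_Iic, orderStat_le_iff h.1 h.2]
    exact measurableSet_le measurable_const (measurable_card_filter_range n fun i =>
      measurableSet_le (measurable_pi_apply i) measurable_const)
  · simp only [orderStat, dif_neg h]
    exact measurable_const

lemma measurable_nearCount (k n : ℕ) (a : ℝ) : Measurable fun x => nearCount x k n a :=
  measurable_card_filter_range n fun i =>
    (measurableSet_lt ((measurable_orderStat k n).sub_const a) (measurable_pi_apply i)).inter
      (measurableSet_lt (measurable_pi_apply i) (measurable_orderStat k n))

lemma nearCount_div_eq_mul (x : ℕ → ℝ) (k n : ℕ) (a c : ℝ) :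
    (nearCount x k n a : ℝ) / c = n / c * (nearCount x k n a / n) := by
  rcases n.eq_zero_or_pos with rfl | hn
  · simp [nearCount]
  · field

end OrderStatistics

section EmpiricalMeasure

variable {x : ℕ → ℝ} {n : ℕ} {s : Set ℝ}

/-- The empirical distribution of `x 0, …, x (n - 1)`; for `n = 0` it is the zero measure. -/
noncomputable def empiricalMeasure (x : ℕ → ℝ) (n : ℕ) : Measure ℝ :=
  (n : ENNReal)⁻¹ • ∑ i ∈ Finset.range n, Measure.dirac (x i)

lemma isProbabilityMeasure_empiricalMeasure (hn : 0 < n) :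
    IsProbabilityMeasure (empiricalMeasure x n) where
  measure_univ := by
    simp [empiricalMeasure, ENNReal.inv_mul_cancel (Nat.cast_ne_zero.2 hn.ne')]

instance : IsFiniteMeasure (empiricalMeasure x n) := by
  rcases n.eq_zero_or_pos with rfl | hn
  · simp only [empiricalMeasure, Finset.range_zero, Finset.sum_empty, smul_zero]
    infer_instance
  · have := isProbabilityMeasure_empiricalMeasure (x := x) hn
    infer_instance

lemma empiricalMeasure_real_apply (hs : MeasurableSet s) :
    (empiricalMeasure x n).real s = (n : ℝ)⁻¹ * ∑ i ∈ Finset.range n, s.indicator 1 (x i) := by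
  have h_dirac (i : ℕ) : (Measure.dirac (x i)).real s = s.indicator 1 (x i) := by
    by_cases h : x i ∈ s <;> simp [Measure.real, Measure.dirac_apply' _ hs, h]
  rw [empiricalMeasure, measureReal_ennreal_smul_apply, ENNReal.toReal_inv, ENNReal.toReal_natCast,
    measureReal_def, Measure.finsetSum_apply, ENNReal.toReal_sum fun i _ => measure_ne_top _ s]
  simp only [← measureReal_def, h_dirac]

lemma empiricalMeasure_real_eq_card_div {p : ℝ → Prop} [DecidablePred p]
    (hp : MeasurableSet {y | p y}) :
    (empiricalMeasure x n).real {y | p y} = {i ∈ Finset.range n | p (x i)}.card / n := by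
  classical
  rw [empiricalMeasure_real_apply hp, Finset.card_filter, div_eq_inv_mul, Nat.cast_sum]
  simp [Set.indicator_apply]

lemma nearCount_div (x : ℕ → ℝ) (k n : ℕ) (a : ℝ) :
    (nearCount x k n a : ℝ) / n =
      (empiricalMeasure x n).real (Set.Ioo (orderStat x k n - a) (orderStat x k n)) :=
  (empiricalMeasure_real_eq_card_div measurableSet_Ioo).symm

end EmpiricalMeasure

section Deterministic

variable {κ : Measure ℝ} {b : EReal} {c : ℝ}

lemma measureReal_setOf_le_eq_setOf_lt (h_atom : κ {y : ℝ | (y : EReal) = b} = 0) :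
    κ.real {y : ℝ | b ≤ y} = κ.real {y : ℝ | b < y} := by
  refine measureReal_congr ?_
  filter_upwards [measure_eq_zero_iff_ae_notMem.1 h_atom] with y hy
  exact propext ⟨fun h => lt_of_le_of_ne h (Ne.symm hy), le_of_lt⟩

variable [IsFiniteMeasure κ]

lemma exists_rat_lt_measureReal_Ioi_lt (hb : b ≠ ⊥) (h : κ.real {y : ℝ | b ≤ y} < c) :
    ∃ q : ℚ, ((q : ℝ) : EReal) < b ∧ κ.real (Set.Ioi (q : ℝ)) < c := by
  have h_inter : {y : ℝ | b ≤ y} = ⋂ q : {q : ℚ // ((q : ℝ) : EReal) < b}, Set.Ioi (q : ℝ) := by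
    ext y
    simp only [Set.mem_ofPred_eq, Set.mem_iInter, Set.mem_Ioi, Subtype.forall]
    refine ⟨fun hy q hq => EReal.coe_lt_coe_iff.1 (hq.trans_le hy), fun hy => ?_⟩
    by_contra! hyb
    obtain ⟨q, hyq, hqb⟩ := EReal.lt_iff_exists_rat_btwn.1 hyb
    exact (hy q hqb).not_gt (EReal.coe_lt_coe_iff.1 hyq)
  obtain ⟨q₀, -, hq₀⟩ := EReal.lt_iff_exists_rat_btwn.1 hb.bot_lt
  have h_anti : Antitone fun q : {q : ℚ // ((q : ℝ) : EReal) < b} => Set.Ioi ((q : ℚ) : ℝ) :=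
    fun p q hpq => Set.Ioi_subset_Ioi (by exact_mod_cast hpq)
  rw [measureReal_def, ← ENNReal.lt_ofReal_iff_toReal_lt (measure_ne_top _ _), h_inter,
    h_anti.measure_iInter (fun _ => measurableSet_Ioi.nullMeasurableSet)
      ⟨⟨q₀, hq₀⟩, measure_ne_top _ _⟩, iInf_lt_iff] at h
  obtain ⟨⟨q, hq⟩, h_lt⟩ := h
  exact ⟨q, hq, (ENNReal.lt_ofReal_iff_toReal_lt (measure_ne_top _ _)).1 h_lt⟩

lemma exists_rat_gt_lt_measureReal_Ioi (hc : 0 ≤ c) (h : c < κ.real {y : ℝ | b < y}) :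
    ∃ q : ℚ, b < ((q : ℝ) : EReal) ∧ c < κ.real (Set.Ioi (q : ℝ)) := by
  have h_union : {y : ℝ | b < y} = ⋃ q : {q : ℚ // b < ((q : ℝ) : EReal)}, Set.Ioi (q : ℝ) := by
    ext y
    simp only [Set.mem_ofPred_eq, Set.mem_iUnion, Set.mem_Ioi, Subtype.exists, exists_prop]
    refine ⟨fun hy => ?_, fun ⟨q, hbq, hqy⟩ => hbq.trans (EReal.coe_lt_coe_iff.2 hqy)⟩
    obtain ⟨q, hbq, hqy⟩ := EReal.lt_iff_exists_rat_btwn.1 hy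
    exact ⟨q, hbq, EReal.coe_lt_coe_iff.1 hqy⟩
  have h_anti : Antitone fun q : {q : ℚ // b < ((q : ℝ) : EReal)} => Set.Ioi ((q : ℚ) : ℝ) :=
    fun p q hpq => Set.Ioi_subset_Ioi (by exact_mod_cast hpq)
  rw [measureReal_def, ← ENNReal.ofReal_lt_iff_lt_toReal hc (measure_ne_top _ _), h_union,
    h_anti.measure_iUnion, lt_iSup_iff] at h
  obtain ⟨⟨q, hq⟩, h_lt⟩ := h
  exact ⟨q, hq, (ENNReal.ofReal_lt_iff_lt_toReal hc (measure_ne_top _ _)).1 h_lt⟩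

variable {x : ℕ → ℝ} {k : ℕ → ℕ} {a : ℝ} {g : EReal}

lemma tendsto_empiricalMeasure_real_setOf_lt
    (h_emp : ∀ q : ℚ, Tendsto (fun n => (empiricalMeasure x n).real (Set.Ioi (q : ℝ))) atTop
      (𝓝 (κ.real (Set.Ioi (q : ℝ)))))
    (hb : b ≠ ⊥) (h_atom : κ {y : ℝ | (y : EReal) = b} = 0) :
    Tendsto (fun n => (empiricalMeasure x n).real {y : ℝ | b < y}) atTop
      (𝓝 (κ.real {y : ℝ | b < y})) := by
  refine tendsto_order.2 ⟨fun c hc => ?_, fun c hc => ?_⟩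
  · rcases lt_or_ge c 0 with hc_neg | hc_nonneg
    · exact .of_forall fun n => hc_neg.trans_le measureReal_nonneg
    obtain ⟨q, hbq, hcq⟩ := exists_rat_gt_lt_measureReal_Ioi hc_nonneg hc
    filter_upwards [(h_emp q).eventually_const_lt hcq] with n hn
    exact hn.trans_le (measureReal_mono fun y hy => hbq.trans (EReal.coe_lt_coe_iff.2 hy))
  · rw [← measureReal_setOf_le_eq_setOf_lt h_atom] at hc
    obtain ⟨q, hqb, hqc⟩ := exists_rat_lt_measureReal_Ioi_lt hb hc
    filter_upwards [(h_emp q).eventually_lt_const hqc] with n hn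
    exact (measureReal_mono fun y hy => EReal.coe_lt_coe_iff.1 (hqb.trans hy)).trans_lt hn

lemma eventually_lt_orderStat {q p : ℝ} (hk : ∀ᶠ n in atTop, k n ≤ n)
    (hk_lim : Tendsto (fun n => (k n : ℝ) / n) atTop (𝓝 1))
    (h_emp : Tendsto (fun n => (empiricalMeasure x n).real (Set.Ioi q)) atTop (𝓝 p))
    (hp : 0 < p) : ∀ᶠ n in atTop, 1 ≤ k n ∧ q < orderStat x (k n) n := by
  have h_sum := (hk_lim.add h_emp).eventually_const_lt (show 1 < 1 + p by linarith)
  filter_upwards [hk, h_sum, hk_lim.eventually_const_lt one_pos, eventually_gt_atTop 0]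
    with n hkn h_sum_n hk_pos hn
  have hk_one : 1 ≤ k n := Nat.one_le_iff_ne_zero.2 fun h => by simp [h] at hk_pos
  refine ⟨hk_one, ?_⟩
  by_contra! h_le
  have := isProbabilityMeasure_empiricalMeasure (x := x) hn
  have h_card : (k n : ℝ) / n ≤ (empiricalMeasure x n).real (Set.Iic q) := by
    rw [Set.Iic, empiricalMeasure_real_eq_card_div measurableSet_Iic]
    gcongr
    exact (orderStat_le_iff hk_one hkn).1 h_le
  rw [← Set.compl_Ioi, probReal_compl_eq_one_sub measurableSet_Ioi] at h_card
  linarith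

/-- The order statistic tends to the right endpoint `g` from below, so the window below it has
asymptotically the same empirical mass as the window of length `a` below `g`. -/
theorem tendsto_nearCount_div (hk : ∀ᶠ n in atTop, k n ≤ n)
    (hk_lim : Tendsto (fun n => (k n : ℝ) / n) atTop (𝓝 1))
    (h_emp : ∀ q : ℚ, Tendsto (fun n => (empiricalMeasure x n).real (Set.Ioi (q : ℝ))) atTop
      (𝓝 (κ.real (Set.Ioi (q : ℝ)))))
    (hx : ∀ i, (x i : EReal) ≤ g)
    (h_pos : ∀ q : ℚ, ((q : ℝ) : EReal) < g → 0 < κ.real (Set.Ioi (q : ℝ)))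
    (h_endpoint : κ {y : ℝ | g ≤ y} = 0)
    (h_atom : κ {y : ℝ | (y : EReal) = g - (a : EReal)} = 0) :
    Tendsto (fun n => (nearCount x (k n) n a : ℝ) / n) atTop
      (𝓝 (κ.real {y : ℝ | g - (a : EReal) < y})) := by
  have hg : g ≠ ⊥ := ((EReal.bot_lt_coe _).trans_le (hx 0)).ne'
  have hb : g - (a : EReal) ≠ ⊥ := by
    simpa [sub_eq_add_neg, EReal.add_eq_bot_iff] using hg
  have h_window := tendsto_empiricalMeasure_real_setOf_lt h_emp hb h_atom
  have h_order (q : ℚ) (hq : ((q : ℝ) : EReal) < g) :=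
    eventually_lt_orderStat hk hk_lim (h_emp q) (h_pos q hq)
  simp only [nearCount_div]
  refine tendsto_order.2 ⟨fun c hc => ?_, fun c hc => ?_⟩
  · obtain ⟨q, hqg, hqc⟩ := exists_rat_lt_measureReal_Ioi_lt hg
      (show κ.real {y : ℝ | g ≤ y} < κ.real {y : ℝ | g - (a : EReal) < y} - c by
        simpa [Measure.real, h_endpoint] using! hc)
    filter_upwards [(h_window.sub (h_emp q)).eventually_const_lt (lt_sub_comm.1 hqc),
      h_order q hqg, hk] with n hn ⟨hk_one, hqn⟩ hkn
    have hM := orderStat_le_of_forall_le hk_one hkn hx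
    refine hn.trans_le (sub_le_iff_le_add.2 ((measureReal_mono fun y hy => ?_).trans
      (measureReal_union_le _ _)))
    refine (le_or_gt y q).imp (fun hyq => ⟨?_, hyq.trans_lt hqn⟩) id
    exact EReal.coe_lt_coe_iff.1 ((EReal.sub_le_sub hM le_rfl).trans_lt hy)
  · rw [← measureReal_setOf_le_eq_setOf_lt h_atom] at hc
    obtain ⟨r, hr, hrc⟩ := exists_rat_lt_measureReal_Ioi_lt hb hc
    obtain ⟨q, hrq, hqg⟩ := EReal.lt_iff_exists_rat_btwn.1
      ((EReal.lt_sub_iff_add_lt (.inr (EReal.coe_ne_top r)) (.inr (EReal.coe_ne_bot r))).1 hr)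
    have hraq : (r : ℝ) + a < q := EReal.coe_lt_coe_iff.1 hrq
    filter_upwards [(h_emp r).eventually_lt_const hrc, h_order q hqg] with n hn ⟨_, hqn⟩
    refine (measureReal_mono fun y hy => ?_).trans_lt hn
    have := hy.1
    exact Set.mem_Ioi.2 (by linarith)

end Deterministic

section CondDistrib

variable {Ω β E : Type*} [MeasurableSpace Ω] {mβ : MeasurableSpace β} [MeasurableSpace E]
  [StandardBorelSpace E] [Nonempty E] {μ : Measure Ω} [IsFiniteMeasure μ]
  {T : Ω → β} {Y : Ω → E} {C : Set (β × E)}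

lemma ae_prodMk_mem_iff_ae_condDistrib (hT : Measurable T) (hY : Measurable Y)
    (hC : MeasurableSet C) :
    (∀ᵐ ω ∂μ, (T ω, Y ω) ∈ C) ↔ ∀ᵐ ω ∂μ, ∀ᵐ y ∂condDistrib Y T μ (T ω), (T ω, y) ∈ C := by
  rw [← ae_map_iff (p := (· ∈ C)) (hT.prodMk hY).aemeasurable hC,
    ← compProd_map_condDistrib hY.aemeasurable, Measure.ae_compProd_iff (p := (· ∈ C)) hC,
    ae_map_iff (p := fun b => ∀ᵐ y ∂condDistrib Y T μ b, (b, y) ∈ C) hT.aemeasurable]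
  exact Kernel.measurable_kernel_prodMk_left hC.compl (measurableSet_singleton 0)

lemma condExp_prodMk_mem_ae_eq_condDistrib (hT : Measurable T) (hY : Measurable Y)
    (hC : MeasurableSet C) :
    μ⟦{ω | (T ω, Y ω) ∈ C} | mβ.comap T⟧ =ᵐ[μ]
      fun ω => (condDistrib Y T μ (T ω)).real {y | (T ω, y) ∈ C} := by
  have h_int : Integrable (fun ω => C.indicator (1 : β × E → ℝ) (T ω, Y ω)) μ :=
    (integrable_const 1).indicator (hT.prodMk hY hC)
  refine (condExp_prod_ae_eq_integral_condDistrib hT hY.aemeasurable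
    (stronglyMeasurable_one.indicator hC) h_int).trans (.of_forall fun ω => ?_)
  exact integral_indicator_one (measurable_prodMk_left hC)

end CondDistrib

section CondRightEndpoint

lemma IsCondRightEndpoint.ae_le {Ω : Type*} {𝓖 : MeasurableSpace Ω} [mΩ : MeasurableSpace Ω]
    {μ : Measure Ω} [IsProbabilityMeasure μ] {Y : Ω → ℝ} {γ : Ω → EReal}
    (hγ : IsCondRightEndpoint μ Y 𝓖 γ) (h𝓖 : 𝓖 ≤ mΩ) (hY : Measurable Y) :
    ∀ᵐ ω ∂μ, (Y ω : EReal) ≤ γ ω :=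
  (condProb_eq_one_iff h𝓖 (measurableSet_le hY.coe_real_ereal (hγ.measurable.mono h𝓖 le_rfl))).1
    hγ.condProb_eq_one

variable {Ω β : Type*} [MeasurableSpace Ω] {mβ : MeasurableSpace β} {μ : Measure Ω}
  [IsProbabilityMeasure μ] {T : Ω → β} {Y : Ω → ℝ} {g : β → EReal} {a : ℝ}

lemma ae_condDistrib_setOf_le_eq_zero (hT : Measurable T) (hY : Measurable Y) (hg : Measurable g)
    (h_lt : ∀ᵐ ω ∂μ, (Y ω : EReal) < g (T ω)) :
    ∀ᵐ ω ∂μ, condDistrib Y T μ (T ω) {y | g (T ω) ≤ y} = 0 := by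
  have h_meas : MeasurableSet {z : β × ℝ | (z.2 : EReal) < g z.1} :=
    measurableSet_lt measurable_snd.coe_real_ereal (hg.comp measurable_fst)
  filter_upwards [(ae_prodMk_mem_iff_ae_condDistrib hT hY h_meas).1 h_lt] with ω hω
  simpa [ae_iff] using! hω

lemma ae_condDistrib_setOf_eq_eq_zero (hT : Measurable T) (hY : Measurable Y) (hg : Measurable g)
    (h_atom : μ {ω | (Y ω : EReal) = g (T ω)} = 0) :
    ∀ᵐ ω ∂μ, condDistrib Y T μ (T ω) {y | (y : EReal) = g (T ω)} = 0 := by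
  have h_meas : MeasurableSet {z : β × ℝ | (z.2 : EReal) = g z.1}ᶜ :=
    (measurableSet_eq_fun measurable_snd.coe_real_ereal (hg.comp measurable_fst)).compl
  filter_upwards [(ae_prodMk_mem_iff_ae_condDistrib hT hY h_meas).1
    (measure_eq_zero_iff_ae_notMem.1 h_atom)] with ω hω
  exact measure_eq_zero_iff_ae_notMem.2 hω

/-- If `q` dominated the conditional law on a non-null event below `g`, lowering `g` to `q` on
this event would contradict minimality. -/
lemma IsCondRightEndpoint.ae_condDistrib_Ioi_pos
    (hγ : IsCondRightEndpoint μ Y (mβ.comap T) (g ∘ T)) (hT : Measurable T) (hY : Measurable Y)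
    (hg : Measurable g) (q : ℝ) :
    ∀ᵐ ω ∂μ, (q : EReal) < g (T ω) → 0 < (condDistrib Y T μ (T ω)).real (Set.Ioi q) := by
  classical
  set κ := condDistrib Y T μ
  have h_null : MeasurableSet {b | κ b (Set.Ioi q) = 0} :=
    Kernel.measurable_coe κ measurableSet_Ioi (measurableSet_singleton 0)
  set g' : β → EReal := fun b => if κ b (Set.Ioi q) = 0 then q else g b
  have hg' : Measurable g' := Measurable.ite h_null measurable_const hg
  have h_meas {f : β → EReal} (hf : Measurable f) :
      MeasurableSet {z : β × ℝ | (z.2 : EReal) ≤ f z.1} :=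
    measurableSet_le measurable_snd.coe_real_ereal (hf.comp measurable_fst)
  have h_le : ∀ᵐ ω ∂μ, (Y ω : EReal) ≤ g' (T ω) := by
    refine (ae_prodMk_mem_iff_ae_condDistrib hT hY (h_meas hg')).2 ?_
    filter_upwards [(ae_prodMk_mem_iff_ae_condDistrib hT hY (h_meas hg)).1
      (hγ.ae_le hT.comap_le hY)] with ω hω
    by_cases h : κ (T ω) (Set.Ioi q) = 0
    · filter_upwards [measure_eq_zero_iff_ae_notMem.1 h] with y hy
      simpa [g', h] using hy
    · simpa [g', h] using hω
  have h_min := hγ.minimal (g' ∘ T) (hg'.comp (comap_measurable T))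
    ((condProb_eq_one_iff hT.comap_le (hT.prodMk hY (h_meas hg'))).2 h_le)
  filter_upwards [h_min] with ω hω hq
  refine ENNReal.toReal_pos (fun h => ?_) (measure_ne_top _ _)
  rw [Function.comp_apply, Function.comp_apply, show g' (T ω) = q from if_pos h] at hω
  exact hω.not_gt hq

lemma limitProportion_ae_eq_condDistrib (hT : Measurable T) (hY : Measurable Y)
    (hg : Measurable g) :
    limitProportion μ Y (mβ.comap T) (g ∘ T) a =ᵐ[μ]
      fun ω => (condDistrib Y T μ (T ω)).real {y | g (T ω) - (a : EReal) < y} := by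
  have h_meas : MeasurableSet {z : β × ℝ | g z.1 - (a : EReal) < z.2} :=
    measurableSet_lt ((hg.comp measurable_fst).sub_const _) measurable_snd.coe_real_ereal
  filter_upwards [condExp_prodMk_mem_ae_eq_condDistrib hT hY h_meas] with ω hω
  rcases (le_top (a := g (T ω))).lt_or_eq with h | h
  · exact (Set.indicator_of_mem (s := {ω | g (T ω) < ⊤}) h _).trans hω
  · rw [limitProportion, Set.indicator_of_notMem (by simp [h])]
    simp [h]

end CondRightEndpoint

section StationaryNearCount

variable {Ω : Type*} [MeasurableSpace Ω] {μ : Measure Ω} [IsProbabilityMeasure μ]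
  {X : ℕ → Ω → ℝ} {k : ℕ → ℕ} {γ : Ω → EReal} {a : ℝ}

lemma StrictlyStationary.ae_tendsto_empiricalMeasure (h : StrictlyStationary μ X)
    (hX : ∀ n, Measurable (X n)) {s : Set ℝ} (hs : MeasurableSet s) :
    ∀ᵐ ω ∂μ, Tendsto (fun n => (empiricalMeasure (path X ω) n).real s) atTop
      (𝓝 ((μ⟦X 0 ⁻¹' s | invariantSigma X⟧) ω)) := by
  have h_int : Integrable (fun x : ℕ → ℝ => s.indicator (1 : ℝ → ℝ) (x 0)) (μ.map (path X)) :=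
    (integrable_const 1).indicator (measurable_pi_apply 0 hs)
  filter_upwards [h.ae_tendsto_birkhoffAverage hX h_int] with ω hω
  refine hω.congr fun n => ?_
  simp only [empiricalMeasure_real_apply hs, birkhoffAverage, birkhoffSum, shift_iterate_apply,
    add_zero, smul_eq_mul]

theorem StrictlyStationary.ae_tendsto_nearCount_div (h : StrictlyStationary μ X)
    (hX : ∀ n, Measurable (X n)) (hk : ∀ᶠ n in atTop, k n ≤ n)
    (hk_lim : Tendsto (fun n => (k n : ℝ) / n) atTop (𝓝 1))
    (hγ : IsCondRightEndpoint μ (X 0) (invariantSigma X) γ)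
    (h_atom : μ {ω | (X 0 ω : EReal) = γ ω} = 0)
    (h_atom_a : μ {ω | (X 0 ω : EReal) = γ ω - (a : EReal)} = 0) :
    ∀ᵐ ω ∂μ, Tendsto (fun n => (nearCount (path X ω) (k n) n a : ℝ) / n) atTop
      (𝓝 (limitProportion μ (X 0) (invariantSigma X) γ a ω)) := by
  have h_le := hγ.ae_le (invariantSigma_le hX) (hX 0)
  have h_all := h.ae_forall_le hX hγ.measurable h_le
  have h_emp := ae_all_iff.2 fun q : ℚ =>
    h.ae_tendsto_empiricalMeasure hX (measurableSet_Ioi (a := (q : ℝ)))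
  have hT : Measurable[_, MeasurableSpace.invariants shift] (path X) :=
    (measurable_path hX).mono le_rfl (MeasurableSpace.invariants_le shift)
  rw [invariantSigma_eq_comap] at hγ h_emp ⊢
  obtain ⟨g, hg, rfl⟩ :=
    Measurable.exists_eq_measurable_comp (mY := MeasurableSpace.invariants shift) hγ.measurable
  have h_lt : ∀ᵐ ω ∂μ, (X 0 ω : EReal) < g (path X ω) := by
    filter_upwards [h_le, measure_eq_zero_iff_ae_notMem.1 h_atom] with ω hω hω_ne
    exact hω.lt_of_ne hω_ne
  have h_condExp := ae_all_iff.2 fun q : ℚ =>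
    condDistrib_ae_eq_condExp (μ := μ) hT (hX 0) (measurableSet_Ioi (a := (q : ℝ)))
  filter_upwards [h_all, h_emp, h_condExp, limitProportion_ae_eq_condDistrib hT (hX 0) hg,
    ae_all_iff.2 fun q : ℚ => hγ.ae_condDistrib_Ioi_pos hT (hX 0) hg q,
    ae_condDistrib_setOf_le_eq_zero hT (hX 0) hg h_lt,
    ae_condDistrib_setOf_eq_eq_zero hT (hX 0) (hg.sub_const _) h_atom_a]
    with ω h_all_ω h_emp_ω h_condExp_ω h_limit h_pos h_endpoint h_atom_ω
  simp only [← h_condExp_ω] at h_emp_ω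
  rw [h_limit]
  exact tendsto_nearCount_div hk hk_lim h_emp_ω h_all_ω h_pos h_endpoint h_atom_ω

end StationaryNearCount

section RandomIndex

variable {Ω ι : Type*} {l : Filter ι} {c : ι → ℝ}

lemma tendsto_atTop_of_tendsto_div {N : ι → ℕ} {z : ℝ} (hz : 0 < z) (hc : Tendsto c l atTop)
    (h : Tendsto (fun t => (N t : ℝ) / c t) l (𝓝 z)) : Tendsto N l atTop := by
  refine (tendsto_natCast_atTop_iff (R := ℝ)).1 ((h.pos_mul_atTop hz hc).congr' ?_)
  filter_upwards [hc.eventually_ne_atTop 0] with t ht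
  exact div_mul_cancel₀ _ ht

lemma tendsto_div_mul_comp {N : ι → ℕ} {y : ℕ → ℝ} {z w : ℝ} (hz : 0 < z)
    (hc : Tendsto c l atTop) (hy : Tendsto y atTop (𝓝 w))
    (h : Tendsto (fun t => (N t : ℝ) / c t) l (𝓝 z)) :
    Tendsto (fun t => N t / c t * y (N t)) l (𝓝 (z * w)) :=
  h.mul (hy.comp (tendsto_atTop_of_tendsto_div hz hc h))

variable [MeasurableSpace Ω] {μ : Measure Ω} {N : ι → Ω → ℕ} {Y : ℕ → Ω → ℝ} {Z W : Ω → ℝ}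

lemma measurable_comp_index {M : Ω → ℕ} (hM : Measurable M) (hY : ∀ n, Measurable (Y n)) :
    Measurable fun ω => Y (M ω) ω :=
  (measurable_from_prod_countable_left (f := fun p : Ω × ℕ => Y p.2 p.1) hY).comp
    (measurable_id.prodMk hM)

/-- Along every sequence in `l`, a subsequence of `N / c` converges almost surely. -/
theorem tendstoInMeasure_div_mul_comp [IsFiniteMeasure μ] [l.IsCountablyGenerated]
    (hN : ∀ t, Measurable (N t)) (hY : ∀ n, Measurable (Y n)) (hZ_pos : ∀ᵐ ω ∂μ, 0 < Z ω)
    (hc : Tendsto c l atTop) (hYW : ∀ᵐ ω ∂μ, Tendsto (fun n => Y n ω) atTop (𝓝 (W ω)))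
    (h : TendstoInMeasure μ (fun t ω => (N t ω : ℝ) / c t) l Z) :
    TendstoInMeasure μ (fun t ω => N t ω / c t * Y (N t ω) ω) l fun ω => Z ω * W ω := by
  intro ε hε
  refine tendsto_of_subseq_tendsto fun u hu => ?_
  obtain ⟨φ, hφ, h_sub⟩ := (h.comp hu).exists_seq_tendsto_ae
  have h_meas (t : ι) : Measurable fun ω => (N t ω : ℝ) / c t * Y (N t ω) ω :=
    ((measurable_from_nat.comp (hN t)).div_const (c t)).mul (measurable_comp_index (hN t) hY)
  refine ⟨φ, tendstoInMeasure_of_tendsto_ae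
    (fun n => (h_meas (u (φ n))).aestronglyMeasurable) ?_ ε hε⟩
  filter_upwards [hYW, hZ_pos, h_sub] with ω hYω hZω h_subω
  exact tendsto_div_mul_comp hZω (hc.comp (hu.comp hφ.tendsto_atTop)) hYω h_subω

lemma tendstoInMeasure_comp_of_ae_tendsto [IsFiniteMeasure μ] (hY : ∀ n, Measurable (Y n))
    (hYW : ∀ᵐ ω ∂μ, Tendsto (fun n => Y n ω) atTop (𝓝 (W ω)))
    (hN_lim : ∀ m, Tendsto (fun t => μ {ω | N t ω < m}) l (𝓝 0)) :
    TendstoInMeasure μ (fun t ω => Y (N t ω) ω) l W := by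
  refine tendstoInMeasure_iff_dist.2 fun ε hε => ENNReal.tendsto_nhds_zero.2 fun δ hδ => ?_
  set D : ℕ → Set Ω := fun m => ⋃ n ≥ m, {ω | ε ≤ dist (Y n ω) (W ω)}
  have hW : AEMeasurable W μ :=
    aemeasurable_of_tendsto_metrizable_ae' (fun n => (hY n).aemeasurable) hYW
  have h_meas (m : ℕ) : NullMeasurableSet (D m) μ :=
    .iUnion fun n => .iUnion fun _ =>
      nullMeasurableSet_le aemeasurable_const ((hY n).aemeasurable.dist hW)
  have h_anti : Antitone D := fun m m' hm =>
    Set.biUnion_subset_biUnion_left fun n (hn : m' ≤ n) => hm.trans hn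
  have h_inter : μ (⋂ m, D m) = 0 := by
    refine measure_eq_zero_iff_ae_notMem.2 ?_
    filter_upwards [hYW] with ω hω h_mem
    obtain ⟨m, hm⟩ := Metric.tendsto_atTop.1 hω ε hε
    obtain ⟨n, hn, h_dist⟩ := Set.mem_iUnion₂.1 (Set.mem_iInter.1 h_mem m)
    exact (hm n hn).not_ge h_dist
  have h_D := tendsto_measure_iInter_atTop h_meas h_anti ⟨0, measure_ne_top μ _⟩
  rw [h_inter] at h_D
  have h_half : 0 < δ / 2 := ENNReal.half_pos hδ.ne'
  obtain ⟨m, hm⟩ := (h_D.eventually_le_const h_half).exists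
  filter_upwards [(hN_lim m).eventually_le_const h_half] with t ht
  have h_sub : {ω | ε ≤ dist (Y (N t ω) ω) (W ω)} ⊆ {ω | N t ω < m} ∪ D m := fun ω hω =>
    (lt_or_ge (N t ω) m).imp id fun h => Set.mem_iUnion₂.2 ⟨N t ω, h, hω⟩
  calc μ {ω | ε ≤ dist (Y (N t ω) ω) (W ω)}
      ≤ μ {ω | N t ω < m} + μ (D m) := (measure_mono h_sub).trans (measure_union_le _ _)
    _ ≤ δ / 2 + δ / 2 := add_le_add ht hm
    _ = δ := ENNReal.add_halves δ

lemma exists_pos_measure_setOf_le_lt [IsFiniteMeasure μ] (hZ : AEMeasurable Z μ)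
    (hZ_pos : ∀ᵐ ω ∂μ, 0 < Z ω) {δ : ENNReal} (hδ : 0 < δ) :
    ∃ ε > 0, μ {ω | Z ω ≤ ε} < δ := by
  have h_inter : μ (⋂ ε > (0 : ℝ), {ω | Z ω ≤ ε}) = 0 := by
    refine measure_eq_zero_iff_ae_notMem.2 ?_
    filter_upwards [hZ_pos] with ω hω h_mem
    exact hω.not_ge (le_of_forall_gt_imp_ge_of_dense fun ε hε => Set.mem_iInter₂.1 h_mem ε hε)
  have h_lim := tendsto_measure_biInter_gt (μ := μ) (s := fun ε => {ω | Z ω ≤ ε}) (a := (0 : ℝ))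
    (fun _ _ => nullMeasurableSet_le hZ aemeasurable_const)
    (fun _ _ _ hij _ hω => le_trans hω hij) ⟨1, one_pos, measure_ne_top _ _⟩
  rw [h_inter] at h_lim
  obtain ⟨ε, h_lt, hε⟩ := ((h_lim.eventually_lt_const hδ).and self_mem_nhdsWithin).exists
  exact ⟨ε, hε, h_lt⟩

variable [IsProbabilityMeasure μ]

lemma eventually_measure_mem_lt_of_isClosed {E : Type*} [TopologicalSpace E] [MeasurableSpace E]
    [OpensMeasurableSpace E] [HasOuterApproxClosed E] {V : ι → Ω → E} {U : Ω → E}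
    (h : TendstoInDistribution V l U (fun _ => μ) μ) {F : Set E} (hF : IsClosed F) {δ : ENNReal}
    (hδ : μ (U ⁻¹' F) < δ) : ∀ᶠ t in l, μ (V t ⁻¹' F) < δ := by
  have h_limsup := ProbabilityMeasure.limsup_measure_closed_le_of_tendsto h.tendsto hF
  simp only [ProbabilityMeasure.coe_mk,
    Measure.map_apply_of_aemeasurable (h.forall_aemeasurable _) hF.measurableSet,
    Measure.map_apply_of_aemeasurable h.aemeasurable_limit hF.measurableSet] at h_limsup
  exact eventually_lt_of_limsup_lt (h_limsup.trans_lt hδ)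

theorem tendstoInMeasure_of_tendstoInDistribution_of_ae_eq_const {E : Type*}
    [PseudoMetricSpace E] [MeasurableSpace E] [OpensMeasurableSpace E] {V : ι → Ω → E}
    {U : Ω → E} (h : TendstoInDistribution V l U (fun _ => μ) μ) {r : E}
    (hU : ∀ᵐ ω ∂μ, U ω = r) : TendstoInMeasure μ V l U := by
  refine .congr_right (g := fun _ => r) (hU.mono fun ω hω => hω.symm) ?_
  refine tendstoInMeasure_iff_dist.2 fun ε hε => ENNReal.tendsto_nhds_zero.2 fun δ hδ => ?_
  have h_closed : IsClosed {y : E | ε ≤ dist y r} :=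
    isClosed_le continuous_const (continuous_id.dist continuous_const)
  have h_null : μ (U ⁻¹' {y | ε ≤ dist y r}) = 0 := by
    refine measure_eq_zero_iff_ae_notMem.2 ?_
    filter_upwards [hU] with ω hω
    simpa [hω] using hε
  exact (eventually_measure_mem_lt_of_isClosed h h_closed (h_null.trans_lt hδ)).mono
    fun t ht => ht.le

lemma tendsto_measure_setOf_lt_of_tendstoInDistribution (hZ_pos : ∀ᵐ ω ∂μ, 0 < Z ω)
    (hc : Tendsto c l atTop)
    (h : TendstoInDistribution (fun t ω => (N t ω : ℝ) / c t) l Z (fun _ => μ) μ) (m : ℕ) :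
    Tendsto (fun t => μ {ω | N t ω < m}) l (𝓝 0) := by
  refine ENNReal.tendsto_nhds_zero.2 fun δ hδ => ?_
  obtain ⟨ε, hε, hZε⟩ := exists_pos_measure_setOf_le_lt h.aemeasurable_limit hZ_pos hδ
  filter_upwards [eventually_measure_mem_lt_of_isClosed h (isClosed_Iic (a := ε)) hZε,
    hc.eventually_ge_atTop (m / ε), hc.eventually_gt_atTop 0] with t ht hmt hct
  refine (measure_mono fun ω hω => ?_).trans ht.le
  have hNm : (N t ω : ℝ) ≤ m := Nat.cast_le.2 (le_of_lt hω)
  exact (div_le_comm₀ hε hct).1 ((div_le_div_of_nonneg_right hNm hε.le).trans hmt)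

theorem tendstoInDistribution_div_mul_comp [l.IsCountablyGenerated] (hN : ∀ t, Measurable (N t))
    (hY : ∀ n, Measurable (Y n)) (hZ_pos : ∀ᵐ ω ∂μ, 0 < Z ω) (hc : Tendsto c l atTop)
    (hYW : ∀ᵐ ω ∂μ, Tendsto (fun n => Y n ω) atTop (𝓝 (W ω))) {r : ℝ} (hW : ∀ᵐ ω ∂μ, W ω = r)
    (h : TendstoInDistribution (fun t ω => (N t ω : ℝ) / c t) l Z (fun _ => μ) μ) :
    TendstoInDistribution (fun t ω => N t ω / c t * Y (N t ω) ω) l (fun ω => Z ω * W ω)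
      (fun _ => μ) μ := by
  have hY_comp : TendstoInMeasure μ (fun t ω => Y (N t ω) ω) l fun _ => r :=
    (tendstoInMeasure_comp_of_ae_tendsto hY hYW
      (tendsto_measure_setOf_lt_of_tendstoInDistribution hZ_pos hc h)).congr_right hW
  refine (h.continuous_comp_prodMk_of_tendstoInMeasure_const continuous_mul hY_comp
    fun t => (measurable_comp_index (hN t) hY).aemeasurable).congr (fun _ => .rfl) ?_
  filter_upwards [hW] with ω hω
  rw [hω]

end RandomIndex

end NearMax

theorem theorem4p2_general {Ω ι : Type*} [MeasurableSpace Ω] {μ : Measure Ω}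
    [IsProbabilityMeasure μ] {l : Filter ι} [l.IsCountablyGenerated] {a : ℝ} {X : ℕ → Ω → ℝ}
    (hX : ∀ n, Measurable (X n)) (hstat : NearMax.StrictlyStationary μ X)
    {k : ℕ → ℕ} (hk : ∀ᶠ n in atTop, k n ≤ n)
    (hk_lim : Tendsto (fun n : ℕ => (k n : ℝ) / (n : ℝ)) atTop (𝓝 1))
    {γ : Ω → EReal} (hγ : NearMax.IsCondRightEndpoint μ (X 0) (NearMax.invariantSigma X) γ)
    (h_atom : μ {ω | (X 0 ω : EReal) = γ ω} = 0)
    (h_atom_a : μ {ω | (X 0 ω : EReal) = γ ω - (a : EReal)} = 0)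
    {N : ι → Ω → ℕ} (hN : ∀ t, Measurable (N t)) {Z : Ω → ℝ} (hZ_pos : ∀ᵐ ω ∂μ, 0 < Z ω)
    {c : ι → ℝ} (hc : Tendsto c l atTop) :
    let K : ι → Ω → ℕ := fun t ω =>
      NearMax.nearCount (fun n => X n ω) (k (N t ω)) (N t ω) a
    let W : Ω → ℝ := NearMax.limitProportion μ (X 0) (NearMax.invariantSigma X) γ a
    ((∀ᵐ ω ∂μ, Tendsto (fun t => (N t ω : ℝ) / c t) l (𝓝 (Z ω))) →
      ∀ᵐ ω ∂μ, Tendsto (fun t => (K t ω : ℝ) / c t) l (𝓝 (Z ω * W ω))) ∧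
    (TendstoInMeasure μ (fun t ω => (N t ω : ℝ) / c t) l Z →
      TendstoInMeasure μ (fun t ω => (K t ω : ℝ) / c t) l (fun ω => Z ω * W ω)) ∧
    (TendstoInDistribution (fun t ω => (N t ω : ℝ) / c t) l Z (fun _ => μ) μ →
      NearMax.Degenerate μ W →
      TendstoInDistribution (fun t ω => (K t ω : ℝ) / c t) l (fun ω => Z ω * W ω)
        (fun _ => μ) μ) ∧
    (TendstoInDistribution (fun t ω => (N t ω : ℝ) / c t) l Z (fun _ => μ) μ →
      NearMax.Degenerate μ Z →
      TendstoInMeasure μ (fun t ω => (N t ω : ℝ) / c t) l Z ∧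
      TendstoInMeasure μ (fun t ω => (K t ω : ℝ) / c t) l (fun ω => Z ω * W ω)) := by
  intro K W
  set Y : ℕ → Ω → ℝ := fun n ω => (NearMax.nearCount (NearMax.path X ω) (k n) n a : ℝ) / n
  have hY (n : ℕ) : Measurable (Y n) := (measurable_from_nat.comp
    ((NearMax.measurable_nearCount (k n) n a).comp (NearMax.measurable_path hX))).div_const _
  have hYW : ∀ᵐ ω ∂μ, Tendsto (fun n => Y n ω) atTop (𝓝 (W ω)) :=
    hstat.ae_tendsto_nearCount_div hX hk hk_lim hγ h_atom h_atom_a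
  have hK (t : ι) (ω : Ω) : (K t ω : ℝ) / c t = N t ω / c t * Y (N t ω) ω :=
    NearMax.nearCount_div_eq_mul _ _ _ _ _
  have h_in_measure := NearMax.tendstoInMeasure_div_mul_comp hN hY hZ_pos hc hYW
  simp only [hK]
  refine ⟨fun h => ?_, h_in_measure, fun h ⟨r, hW⟩ =>
    NearMax.tendstoInDistribution_div_mul_comp hN hY hZ_pos hc hYW hW h, fun h ⟨r, hZ⟩ => ?_⟩
  · filter_upwards [h, hYW, hZ_pos] with ω hω hYω hZω
    exact NearMax.tendsto_div_mul_comp hZω hc hYω hω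
  · have hNZ := NearMax.tendstoInMeasure_of_tendstoInDistribution_of_ae_eq_const h hZ
    exact ⟨hNZ, h_in_measure hNZ⟩

/-- `X n` stands for the claim size with index `n + 1`, and `γ` for any version of the conditional
right endpoint of the first claim size given the invariant sigma-field of the sequence. -/
theorem theorem4p2 {Ω : Type*} [MeasurableSpace Ω] (μ : Measure Ω) [IsProbabilityMeasure μ]
    (a : ℝ) (ha : 0 < a)
    -- the strictly stationary sequence of claim sizes
    (X : ℕ → Ω → ℝ) (hX : ∀ n, Measurable (X n)) (hstat : NearMax.StrictlyStationary μ X)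
    -- the ranks
    (k : ℕ → ℕ) (hk : ∀ n, 1 ≤ n → 1 ≤ k n ∧ k n ≤ n)
    (hk_lim : Tendsto (fun n : ℕ => (k n : ℝ) / (n : ℝ)) atTop (𝓝 1))
    -- the conditional right endpoint and the two conditions on atoms
    (γ : Ω → EReal) (hγ : NearMax.IsCondRightEndpoint μ (X 0) (NearMax.invariantSigma X) γ)
    (h_atom : μ {ω | (X 0 ω : EReal) = γ ω} = 0)
    (h_atom_a : μ {ω | (X 0 ω : EReal) = γ ω - (a : EReal)} = 0)
    -- the counting process, its normalization and the limit
    (N : ℝ≥0 → Ω → ℕ) (hN : ∀ t, Measurable (N t))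
    (Z : Ω → ℝ) (hZ : Measurable Z) (hZ_pos : ∀ᵐ ω ∂μ, 0 < Z ω)
    (c : ℝ≥0 → ℝ) (hc_pos : ∀ t, 0 < c t) (hc : Tendsto c atTop atTop) :
    let K : ℝ≥0 → Ω → ℕ := fun t ω =>
      NearMax.nearCount (fun n => X n ω) (k (N t ω)) (N t ω) a
    let W : Ω → ℝ := NearMax.limitProportion μ (X 0) (NearMax.invariantSigma X) γ a
    -- (i), almost sure convergence
    ((∀ᵐ ω ∂μ, Tendsto (fun t => (N t ω : ℝ) / c t) atTop (𝓝 (Z ω))) →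
      ∀ᵐ ω ∂μ, Tendsto (fun t => (K t ω : ℝ) / c t) atTop (𝓝 (Z ω * W ω))) ∧
    -- (i), convergence in probability
    (TendstoInMeasure μ (fun t ω => (N t ω : ℝ) / c t) atTop Z →
      TendstoInMeasure μ (fun t ω => (K t ω : ℝ) / c t) atTop (fun ω => Z ω * W ω)) ∧
    -- (ii), convergence in distribution
    (TendstoInDistribution (fun t ω => (N t ω : ℝ) / c t) atTop Z (fun _ => μ) μ →
      NearMax.Degenerate μ W →
      TendstoInDistribution (fun t ω => (K t ω : ℝ) / c t) atTop (fun ω => Z ω * W ω)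
        (fun _ => μ) μ) ∧
    -- (ii), degenerate `Z`
    (TendstoInDistribution (fun t ω => (N t ω : ℝ) / c t) atTop Z (fun _ => μ) μ →
      NearMax.Degenerate μ Z →
      TendstoInMeasure μ (fun t ω => (N t ω : ℝ) / c t) atTop Z ∧
      TendstoInMeasure μ (fun t ω => (K t ω : ℝ) / c t) atTop (fun ω => Z ω * W ω)) := by
  exact theorem4p2_general hX hstat ((eventually_ge_atTop 1).mono fun n hn => (hk n hn).2) hk_lim
    hγ h_atom h_atom_a hN hZ_pos hc
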